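/- Let \(h:\mathbb F_2^u\to\mathbb F_2^\ell\) be a uniformly random linear map, let \(S\subseteq\mathbb F_2^u\) be a nonempty set of \(m\) keys, let \(n=2^\ell\) be the number of bins, and let \(\lambda=m/n\). Let \(\mathsf M(S,h)=\max_{y\in\mathbb F_2^\ell}|h^{-1}(y)\cap S|\) be the maximum load, and let \(t=t(m,n)>0\) be the positive number defined by \[ t\ln\left(\frac{t}{e\lambda}\right)=\ln n . \] Then, as \(t/\lambda\to\infty\), \[ \mathbb E_h[\mathsf M(S,h)]\le(1+o(1))\,t , \] where the \(o(1)\) term depends only on \(t/\lambda\). That is, for every \(\varepsilon>0\) there is a \(K\) such that \(\mathbb E_h[\mathsf M(S,h)]\le(1+\varepsilon)t\) for all \(\ell,u\ge 0\) and all nonempty \(S\subseteq\mathbb F_2^u\) with \(t/\lambda\ge K\). -/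

import Mathlib

/-- The vector space `𝔽₂ ^ k`. -/
abbrev BinVec (k : ℕ) : Type := Fin k → ZMod 2

namespace BinaryLinearHashing

open scoped BigOperators

/-- The load of the bin `y`: the number of keys `x ∈ S` with `h x = y`. -/
def load {u l : ℕ} (S : Finset (BinVec u)) (h : BinVec u →ₗ[ZMod 2] BinVec l)
    (y : BinVec l) : ℕ :=
  (S.filter fun x => h x = y).card

/-- The maximum load `M(S, h)`, a maximum over all `2 ^ l` bins. -/
def maxLoad {u l : ℕ} (S : Finset (BinVec u)) (h : BinVec u →ₗ[ZMod 2] BinVec l) : ℕ :=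
  Finset.univ.sup (load S h)

/-- There are finitely many linear maps between finite binary vector spaces. -/
noncomputable instance instFintypeHash (u l : ℕ) :
    Fintype (BinVec u →ₗ[ZMod 2] BinVec l) :=
  DFunLike.fintype _

/-- The expected maximum load `E_h[M(S, h)]`, where `h` is uniformly distributed on the
(finite, nonempty) set of all linear maps `𝔽₂ ^ u → 𝔽₂ ^ l`. -/
noncomputable def expectedMaxLoad {u : ℕ} (l : ℕ) (S : Finset (BinVec u)) : ℝ :=
  (∑ h : BinVec u →ₗ[ZMod 2] BinVec l, (maxLoad S h : ℝ)) /
    (Fintype.card (BinVec u →ₗ[ZMod 2] BinVec l) : ℝ)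

/-- The average load `λ = m / n`, where `m = |S|` keys are hashed to `n = 2 ^ l` bins. -/
noncomputable def avgLoad {u : ℕ} (l : ℕ) (S : Finset (BinVec u)) : ℝ :=
  (S.card : ℝ) / (2 : ℝ) ^ l

/-- `t` is the fully independent comparison scale for the average load `lam` and `n` bins:
the positive solution of `t ln (t / (e λ)) = ln n`. It exists and is unique when
`lam > 0` and `n ≥ 1` (positivity singles out the branch `t ≥ e λ`). -/
def IsLoadScale (lam n t : ℝ) : Prop :=
  0 < t ∧ t * Real.log (t / (Real.exp 1 * lam)) = Real.log n

end BinaryLinearHashing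

namespace BinaryLinearHashing

open scoped BigOperators

/-! Fix θ ≥ 1, let Φ_N(h) = ∑ θ^load for a uniform map h to N bits, and let A_N = E ln Φ_N − N ln 2.
The core is A_N ≤ 2 A_{N+1} (`meanLogPotential_le_succ`), so 2^N A_N never decreases as output bits
are added. Forgetting a bit of a map to N+1 bits merges the bins y and y + e, so the new potential
is half the correlation in direction e. By symmetry under the general linear group all nonzero
directions have the same mean log-correlation. Jensen over directions, with direction 0 at least
average, bounds this mean by E ln(Φ² / 2^(N+1)). As N → ∞ collisions disappear and 2^N A_N is at
most |S|(θ − 1) in the limit, hence A_l ≤ λ(θ − 1). Since θ^M ≤ Φ, this gives E[M] ln θ ≤ ln n + λ(θ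
− 1), and θ = t/λ yields E[M] ≤ t with no error term. -/

/-- Averaging over a finite additive group is compatible with surjective homomorphisms. -/
theorem sum_comp_div_card_of_surjective {A B : Type*} [AddGroup A] [AddGroup B] [Fintype A]
    [Fintype B] (φ : A →+ B) (hφ : Function.Surjective φ) (G : B → ℝ) :
    (∑ a, G (φ a)) / (Fintype.card A : ℝ) = (∑ b, G b) / (Fintype.card B : ℝ) := by
  classical
  set c : ℕ := (Finset.univ.filter fun a => φ a = 0).card with hc
  have hfib : ∀ b : B, (Finset.univ.filter fun a => φ a = b).card = c := fun b =>
    AddMonoidHom.card_fiber_eq_of_mem_range φ (hφ b) (hφ 0)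
  have hsum : ∀ F : B → ℝ, ∑ a, F (φ a) = c * ∑ b, F b := by
    intro F
    rw [← Finset.sum_fiberwise_of_maps_to (g := φ) (t := Finset.univ) (by simp), Finset.mul_sum]
    refine Finset.sum_congr rfl fun b _ => ?_
    rw [Finset.sum_congr rfl (g := fun _ => F b)
      (by intro a ha; rw [(Finset.mem_filter.1 ha).2]), Finset.sum_const, hfib, nsmul_eq_mul]
  have hcard : (Fintype.card A : ℝ) = c * Fintype.card B := by simpa using hsum fun _ => 1
  have hA : (Fintype.card A : ℝ) ≠ 0 := by
    have : 0 < Fintype.card A := Fintype.card_pos_iff.2 ⟨0⟩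
    positivity
  have hc0 : (c : ℝ) ≠ 0 := fun h => hA (by rw [hcard, h, zero_mul])
  rw [hsum, hcard, mul_div_mul_left _ _ hc0]

/-- The general linear group acts transitively on nonzero vectors. -/
theorem exists_linearEquiv_apply_eq {K V : Type*} [Field K] [AddCommGroup V] [Module K V]
    [FiniteDimensional K V] {v w : V} (hv : v ≠ 0) (hw : w ≠ 0) : ∃ T : V ≃ₗ[K] V, T v = w := by
  obtain ⟨g, hg⟩ := Submodule.exists_linearEquiv_restrict_eq
    ((LinearEquiv.toSpanNonzeroSingleton K V v hv).symm ≪≫ₗ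
      LinearEquiv.toSpanNonzeroSingleton K V w hw)
  refine ⟨g, ?_⟩
  have h := hg (LinearEquiv.toSpanNonzeroSingleton K V v hv 1)
  rw [LinearEquiv.trans_apply, LinearEquiv.symm_apply_apply] at h
  simpa using h.symm

/-- Jensen's inequality for `Real.log` over a finite type. -/
theorem sum_log_le_card_mul_log {ι : Type*} [Fintype ι] [Nonempty ι] (q : ι → ℝ)
    (hq : ∀ i, 0 < q i) :
    ∑ i, Real.log (q i) ≤ Fintype.card ι * Real.log ((∑ i, q i) / Fintype.card ι) := by
  have hD : (0 : ℝ) < Fintype.card ι := by exact_mod_cast Fintype.card_pos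
  have hs : 0 < ∑ i, q i := Finset.sum_pos (fun i _ => hq i) Finset.univ_nonempty
  set a := (∑ i, q i) / Fintype.card ι with ha
  have ha0 : 0 < a := div_pos hs hD
  have h1 : ∀ i, Real.log (q i) ≤ Real.log a + (q i / a - 1) := by
    intro i
    have := Real.log_le_sub_one_of_pos (div_pos (hq i) ha0)
    rw [Real.log_div (hq i).ne' ha0.ne'] at this
    linarith
  refine (Finset.sum_le_sum fun i _ => h1 i).trans (le_of_eq ?_)
  have h2 : (∑ i, q i) / a = Fintype.card ι := by
    rw [ha]; field_simp
  simp only [Finset.sum_add_distrib, Finset.sum_sub_distrib, ← Finset.sum_div, h2]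
  simp

/-! ### Potential and its correlations -/

section Potential

variable {u : ℕ} (S : Finset (BinVec u)) (θ : ℝ)

/-- The exponential potential `∑ y, θ ^ load y`. -/
noncomputable def potential {N : ℕ} (h : BinVec u →ₗ[ZMod 2] BinVec N) : ℝ :=
  ∑ y, θ ^ load S h y

/-- The correlation `∑ y, θ ^ (load y + load (y + v))` of the potential along the direction `v`. -/
noncomputable def correlation {N : ℕ} (h : BinVec u →ₗ[ZMod 2] BinVec N) (v : BinVec N) : ℝ :=
  ∑ y, θ ^ (load S h y + load S h (y + v))

/-- The mean over all linear maps of `ln (potential)`. -/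
noncomputable def meanLogPotential (N : ℕ) : ℝ :=
  (∑ h : BinVec u →ₗ[ZMod 2] BinVec N, Real.log (potential S θ h)) /
    (Fintype.card (BinVec u →ₗ[ZMod 2] BinVec N) : ℝ)

variable {θ}

theorem card_hash_pos (u N : ℕ) :
    (0 : ℝ) < Fintype.card (BinVec u →ₗ[ZMod 2] BinVec N) := by
  exact_mod_cast Fintype.card_pos

theorem card_binVec (N : ℕ) : (Fintype.card (BinVec N) : ℝ) = 2 ^ N := by
  simp [ZMod.card]

theorem potential_pos {N : ℕ} (hθ : 0 < θ) (h : BinVec u →ₗ[ZMod 2] BinVec N) :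
    0 < potential S θ h :=
  Finset.sum_pos (fun _ _ => pow_pos hθ _) Finset.univ_nonempty

theorem correlation_pos {N : ℕ} (hθ : 0 < θ) (h : BinVec u →ₗ[ZMod 2] BinVec N) (v : BinVec N) :
    0 < correlation S θ h v :=
  Finset.sum_pos (fun _ _ => pow_pos hθ _) Finset.univ_nonempty

theorem sum_load {N : ℕ} (h : BinVec u →ₗ[ZMod 2] BinVec N) :
    ∑ y, load S h y = S.card :=
  (Finset.card_eq_sum_card_fiberwise (t := Finset.univ) (by simp)).symm

theorem load_le_card {N : ℕ} (h : BinVec u →ₗ[ZMod 2] BinVec N) (y : BinVec N) :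
    load S h y ≤ S.card := Finset.card_filter_le _ _

theorem load_equiv_comp {N : ℕ} (h : BinVec u →ₗ[ZMod 2] BinVec N)
    (T : BinVec N ≃ₗ[ZMod 2] BinVec N) (y : BinVec N) :
    load S (T.toLinearMap ∘ₗ h) (T y) = load S h y := by
  simp [load]

theorem correlation_equiv_comp {N : ℕ} (h : BinVec u →ₗ[ZMod 2] BinVec N)
    (T : BinVec N ≃ₗ[ZMod 2] BinVec N) (v : BinVec N) :
    correlation S θ (T.toLinearMap ∘ₗ h) (T v) = correlation S θ h v := by
  unfold correlation
  rw [← Equiv.sum_comp T.toEquiv]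
  refine Finset.sum_congr rfl fun y _ => ?_
  have h2 := load_equiv_comp S h T (y + v)
  rw [map_add] at h2
  change θ ^ (load S (T.toLinearMap ∘ₗ h) (T y) + load S (T.toLinearMap ∘ₗ h) (T y + T v)) = _
  rw [h2, load_equiv_comp]

/-- All nonzero directions contribute equally after summation over the hash functions. -/
theorem sum_log_correlation_eq {N : ℕ} {v w : BinVec N} (hv : v ≠ 0) (hw : w ≠ 0) :
    ∑ h : BinVec u →ₗ[ZMod 2] BinVec N, Real.log (correlation S θ h v) =
      ∑ h : BinVec u →ₗ[ZMod 2] BinVec N, Real.log (correlation S θ h w) := by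
  obtain ⟨T, rfl⟩ := exists_linearEquiv_apply_eq (K := ZMod 2) hv hw
  rw [← Equiv.sum_comp (LinearEquiv.congrRight (M := BinVec u) T).toEquiv
    (fun h => Real.log (correlation S θ h (T v)))]
  exact Finset.sum_congr rfl fun h _ => congrArg Real.log (correlation_equiv_comp S h T v).symm

theorem sum_correlation {N : ℕ} (h : BinVec u →ₗ[ZMod 2] BinVec N) :
    ∑ v, correlation S θ h v = potential S θ h ^ 2 := by
  unfold correlation potential
  rw [Finset.sum_comm, sq, Finset.sum_mul]
  refine Finset.sum_congr rfl fun y _ => ?_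
  simp only [pow_add, ← Finset.mul_sum]
  congr 1
  exact Equiv.sum_comp (Equiv.addLeft y) fun z => θ ^ load S h z

/-- Cauchy–Schwarz: in characteristic 2 every translate pairs with itself only for direction 0,
where the correlation is a sum of squares and so at least the average over all directions. -/
theorem sq_potential_div_le_correlation_zero {N : ℕ} (h : BinVec u →ₗ[ZMod 2] BinVec N) :
    potential S θ h ^ 2 / 2 ^ N ≤ correlation S θ h 0 := by
  rw [div_le_iff₀ (by positivity)]
  have := sq_sum_le_card_mul_sum_sq (s := Finset.univ) (f := fun y => θ ^ load S h y)
  rw [Finset.card_univ, card_binVec] at this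
  refine this.trans (le_of_eq ?_)
  rw [mul_comm]
  simp [correlation, sq, pow_add]

/-- For fixed `h`, Jensen bounds the sum of log-correlations over all directions by `2 ^ N` times
the log of their average. The zero direction is at least that average, so discarding it keeps the
bound for the other `2 ^ N - 1`. These agree after summing over `h`. -/
theorem sum_log_correlation_le {N : ℕ} (hθ : 0 < θ) {e : BinVec N} (he : e ≠ 0) :
    ∑ h : BinVec u →ₗ[ZMod 2] BinVec N, Real.log (correlation S θ h e) ≤
      ∑ h : BinVec u →ₗ[ZMod 2] BinVec N, Real.log (potential S θ h ^ 2 / 2 ^ N) := by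
  have hD : (1 : ℝ) < 2 ^ N := by
    rw [← card_binVec]
    exact_mod_cast Fintype.one_lt_card_iff.2 ⟨e, 0, he⟩
  have key : ∀ h : BinVec u →ₗ[ZMod 2] BinVec N,
      ∑ v ∈ Finset.univ.erase (0 : BinVec N), Real.log (correlation S θ h v) ≤
        (2 ^ N - 1) * Real.log (potential S θ h ^ 2 / 2 ^ N) := by
    intro h
    have h1 := sum_log_le_card_mul_log _ (correlation_pos S hθ h)
    rw [sum_correlation, card_binVec,
      ← Finset.add_sum_erase _ _ (Finset.mem_univ (0 : BinVec N))] at h1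
    have h2 := Real.log_le_log (div_pos (pow_pos (potential_pos S hθ h) 2) (by positivity))
      (sq_potential_div_le_correlation_zero S h)
    linarith
  have h3 := Finset.sum_le_sum fun h (_ : h ∈ Finset.univ) => key h
  rw [Finset.sum_comm, Finset.sum_congr rfl (g := fun _ =>
      ∑ h : BinVec u →ₗ[ZMod 2] BinVec N, Real.log (correlation S θ h e))
      (fun v hv => sum_log_correlation_eq S (Finset.ne_of_mem_erase hv) he),
    Finset.sum_const, Finset.card_erase_of_mem (Finset.mem_univ _), Finset.card_univ,
    nsmul_eq_mul, Nat.cast_sub Fintype.card_pos, card_binVec, ← Finset.mul_sum,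
    Nat.cast_one] at h3
  exact le_of_mul_le_mul_left h3 (by linarith)

/-! ### Adding one output bit -/

/-- Forgetting the first output bit. -/
def dropBit (N : ℕ) : BinVec (N + 1) →ₗ[ZMod 2] BinVec N :=
  LinearMap.funLeft (ZMod 2) (ZMod 2) Fin.succ

theorem load_dropBit {N : ℕ} (h : BinVec u →ₗ[ZMod 2] BinVec (N + 1)) (b : ZMod 2)
    (y : BinVec N) :
    load S (dropBit N ∘ₗ h) y =
      load S h (Fin.cons b y) + load S h (Fin.cons (b + 1) y) := by
  unfold load
  rw [← Finset.card_union_of_disjoint, ← Finset.filter_or]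
  · congr 1
    refine Finset.filter_congr fun x _ => ?_
    have h0 : h x 0 = b ∨ h x 0 = b + 1 := by
      generalize h x 0 = a
      revert a b; decide
    have h1 : ∀ c : ZMod 2, h x = (Fin.cons c y : BinVec (N + 1)) ↔
        h x 0 = c ∧ dropBit N (h x) = y := by
      intro c
      rw [← Fin.cons_self_tail (h x), Fin.cons_inj]
      rfl
    rw [h1, h1]
    simp only [LinearMap.comp_apply]
    tauto
  · rw [Finset.disjoint_filter]
    intro x _ h1 h2
    rw [h1, Fin.cons_inj] at h2
    have : ∀ b : ZMod 2, b ≠ b + 1 := by decide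
    exact this b h2.1

/-- Translation by `Pi.single 0 1` flips the forgotten bit, so each merged bin appears twice in the
correlation, once per value of that bit. -/
theorem potential_dropBit {N : ℕ} (h : BinVec u →ₗ[ZMod 2] BinVec (N + 1)) :
    potential S θ (dropBit N ∘ₗ h) = correlation S θ h (Pi.single 0 1) / 2 := by
  have h1 : correlation S θ h (Pi.single 0 1) =
      ∑ b : ZMod 2, ∑ y : BinVec N, θ ^ load S (dropBit N ∘ₗ h) y := by
    rw [← Fintype.sum_prod_type', correlation,
      ← Equiv.sum_comp (Fin.consEquiv fun _ : Fin (N + 1) => ZMod 2)]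
    refine Finset.sum_congr rfl fun p _ => ?_
    rw [load_dropBit S h p.1]
    congr 3
    ext i
    refine Fin.cases ?_ (fun j => ?_) i <;> simp [Fin.consEquiv]
  rw [h1]
  simp [potential, ZMod.card]

theorem dropBit_comp_surjective (u N : ℕ) :
    Function.Surjective fun h : BinVec u →ₗ[ZMod 2] BinVec (N + 1) => dropBit N ∘ₗ h := by
  intro g
  obtain ⟨s, hs⟩ := (dropBit N).exists_rightInverse_of_surjective
    (LinearMap.range_eq_top.2 (LinearMap.funLeft_surjective_of_injective _ _ _
      (Fin.succ_injective _)))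
  exact ⟨s ∘ₗ g, by simp only [← LinearMap.comp_assoc, hs, LinearMap.id_comp]⟩

/-- The rescaled mean log-potential grows with the number of output bits. -/
theorem meanLogPotential_le_succ (hθ : 0 < θ) (N : ℕ) :
    meanLogPotential S θ N - N * Real.log 2 ≤
      2 * (meanLogPotential S θ (N + 1) - (N + 1) * Real.log 2) := by
  have hc := card_hash_pos u (N + 1)
  have h1 : (∑ h : BinVec u →ₗ[ZMod 2] BinVec (N + 1),
      Real.log (potential S θ (dropBit N ∘ₗ h))) /
        Fintype.card (BinVec u →ₗ[ZMod 2] BinVec (N + 1)) = meanLogPotential S θ N :=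
    sum_comp_div_card_of_surjective
      (LinearMap.compRight (ZMod 2) (M := BinVec u) (dropBit N)).toAddMonoidHom
      (dropBit_comp_surjective u N) fun g => Real.log (potential S θ g)
  have h2 : ∀ h : BinVec u →ₗ[ZMod 2] BinVec (N + 1),
      Real.log (potential S θ (dropBit N ∘ₗ h)) =
        Real.log (correlation S θ h (Pi.single 0 1)) - Real.log 2 := by
    intro h
    rw [potential_dropBit, Real.log_div (correlation_pos S hθ h _).ne' two_ne_zero]
  have h3 : ∀ h : BinVec u →ₗ[ZMod 2] BinVec (N + 1),
      Real.log (potential S θ h ^ 2 / 2 ^ (N + 1)) =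
        2 * Real.log (potential S θ h) - (N + 1) * Real.log 2 := by
    intro h
    rw [Real.log_div (pow_pos (potential_pos S hθ h) 2).ne' (by positivity), Real.log_pow,
      Real.log_pow]
    push_cast; ring
  have h4 := sum_log_correlation_le S hθ (e := (Pi.single 0 1 : BinVec (N + 1))) (by simp)
  simp only [h3, Finset.sum_sub_distrib, ← Finset.mul_sum, Finset.sum_const, Finset.card_univ,
    nsmul_eq_mul] at h4
  have h5 : meanLogPotential S θ N =
      (∑ h : BinVec u →ₗ[ZMod 2] BinVec (N + 1),
        Real.log (correlation S θ h (Pi.single 0 1))) /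
        Fintype.card (BinVec u →ₗ[ZMod 2] BinVec (N + 1)) - Real.log 2 := by
    rw [← h1, eq_sub_iff_add_eq, div_add' _ _ _ hc.ne']
    congr 1
    rw [Finset.sum_congr rfl (fun h _ => h2 h), Finset.sum_sub_distrib]
    simp only [Finset.sum_const, Finset.card_univ, nsmul_eq_mul]
    ring
  have h6 := div_le_div_of_nonneg_right h4 hc.le
  rw [sub_div, mul_div_assoc, mul_div_assoc, mul_div_cancel_left₀ _ hc.ne'] at h6
  rw [h5]
  unfold meanLogPotential
  linarith

theorem scaled_meanLogPotential_le (hθ : 0 < θ) (l k : ℕ) :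
    2 ^ l * (meanLogPotential S θ l - l * Real.log 2) ≤
      2 ^ (l + k) * (meanLogPotential S θ (l + k) - (l + k : ℕ) * Real.log 2) := by
  induction k with
  | zero => simp
  | succ k ih =>
    refine ih.trans ?_
    have := mul_le_mul_of_nonneg_left (meanLogPotential_le_succ S hθ (l + k))
      (by positivity : (0 : ℝ) ≤ 2 ^ (l + k))
    refine this.trans (le_of_eq ?_)
    rw [← add_assoc, pow_succ]
    push_cast; ring

/-! ### The limit of many output bits -/

/-- A nonzero key is sent to zero with probability `2 ^ (-N)`. -/
theorem prob_apply_eq_zero {N : ℕ} {x : BinVec u} (hx : x ≠ 0) :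
    (∑ h : BinVec u →ₗ[ZMod 2] BinVec N, if h x = 0 then (1 : ℝ) else 0) /
      Fintype.card (BinVec u →ₗ[ZMod 2] BinVec N) = 1 / 2 ^ N := by
  have h1 := sum_comp_div_card_of_surjective
    (LinearMap.applyₗ (R := ZMod 2) (M₂ := BinVec N) x).toAddMonoidHom (fun y => by
      obtain ⟨f, hf⟩ := Module.Projective.exists_dual_eq_one (ZMod 2) hx
      exact ⟨f.smulRight y, by simp [hf]⟩) fun y => if y = 0 then (1 : ℝ) else 0
  simpa [ZMod.card] using h1

/-- If `h` is injective, all loads are at most 1 and the first term is exact. Otherwise the sum of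
indicators is at least 1, and the crude bound `S.card * θ ^ S.card` suffices since its probability
will tend to 0. -/
theorem potential_sub_le {N : ℕ} (hθ : 1 ≤ θ) (h : BinVec u →ₗ[ZMod 2] BinVec N) :
    potential S θ h - 2 ^ N ≤ S.card * (θ - 1) +
      S.card * θ ^ S.card * ∑ x ∈ Finset.univ.erase (0 : BinVec u), if h x = 0 then 1 else 0 := by
  have hpot : potential S θ h - 2 ^ N = ∑ y, (θ ^ load S h y - 1) := by
    rw [Finset.sum_sub_distrib, ← card_binVec]
    simp [potential]
  have hS : (S.card : ℝ) = ∑ y, (load S h y : ℝ) := by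
    rw [← sum_load S h]; push_cast; rfl
  have hθS : 1 ≤ θ ^ S.card := one_le_pow₀ hθ
  have hnn : (0 : ℝ) ≤ ∑ x ∈ Finset.univ.erase (0 : BinVec u), if h x = 0 then 1 else 0 :=
    Finset.sum_nonneg fun x _ => by split_ifs <;> norm_num
  rw [hpot]
  by_cases hinj : ∀ x, x ≠ 0 → h x ≠ 0
  · have hle : ∀ y, load S h y ≤ 1 := by
      intro y
      refine Finset.card_le_one.2 fun a ha b hb => ?_
      by_contra hab
      refine hinj (a - b) (sub_ne_zero.2 hab) ?_
      rw [map_sub, (Finset.mem_filter.1 ha).2, (Finset.mem_filter.1 hb).2, sub_self]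
    have h1 : ∑ y, (θ ^ load S h y - 1) = S.card * (θ - 1) := by
      rw [hS, Finset.sum_mul]
      refine Finset.sum_congr rfl fun y _ => ?_
      have := hle y
      interval_cases load S h y <;> simp
    rw [h1]
    have : 0 ≤ (S.card : ℝ) * θ ^ S.card := by positivity
    nlinarith [mul_nonneg this hnn]
  · push Not at hinj
    obtain ⟨x, hx, hx0⟩ := hinj
    have h1 : (1 : ℝ) ≤ ∑ x ∈ Finset.univ.erase (0 : BinVec u), if h x = 0 then 1 else 0 := by
      have := Finset.single_le_sum (f := fun x => if h x = 0 then (1 : ℝ) else 0)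
        (fun x _ => by split_ifs <;> norm_num)
        (Finset.mem_erase.2 ⟨hx, Finset.mem_univ x⟩)
      simpa [hx0] using this
    have h2 : ∑ y, (θ ^ load S h y - 1) ≤ S.card * θ ^ S.card := by
      rw [hS, Finset.sum_mul]
      refine Finset.sum_le_sum fun y _ => ?_
      rcases Nat.eq_zero_or_pos (load S h y) with h0 | h0
      · simp [h0]
      · have h3 : θ ^ load S h y ≤ θ ^ S.card := pow_le_pow_right₀ hθ (load_le_card S h y)
        have h4 : (1 : ℝ) ≤ load S h y := by exact_mod_cast h0
        nlinarith
    have h5 : (0 : ℝ) ≤ S.card * (θ - 1) := mul_nonneg (by positivity) (by linarith)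
    have h6 : 0 ≤ (S.card : ℝ) * θ ^ S.card := by positivity
    nlinarith [mul_le_mul_of_nonneg_left h1 h6]

/-- Combines ln x ≤ x − 1 at x = Φ / 2^N with a union bound over the nonzero vectors of the key
space; the error vanishes as `N` grows with `u`, `S`, `θ` fixed. -/
theorem scaled_meanLogPotential_le_of_prob (hθ : 1 ≤ θ) (N : ℕ) :
    2 ^ N * (meanLogPotential S θ N - N * Real.log 2) ≤
      S.card * (θ - 1) + S.card * θ ^ S.card * 2 ^ u * (1 / 2) ^ N := by
  have hc := card_hash_pos u N
  set C : ℝ := ((Fintype.card (BinVec u →ₗ[ZMod 2] BinVec N) : ℕ) : ℝ) with hC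
  have hP : (0 : ℝ) < 2 ^ N := by positivity
  have h1 : ∀ h : BinVec u →ₗ[ZMod 2] BinVec N,
      2 ^ N * (Real.log (potential S θ h) - N * Real.log 2) ≤ S.card * (θ - 1) +
        S.card * θ ^ S.card *
          ∑ x ∈ Finset.univ.erase (0 : BinVec u), if h x = 0 then 1 else 0 := by
    intro h
    refine le_trans ?_ (potential_sub_le S hθ h)
    have hp := potential_pos S (zero_lt_one.trans_le hθ) h
    have := Real.log_le_sub_one_of_pos (div_pos hp hP)
    rw [Real.log_div hp.ne' hP.ne', Real.log_pow] at this
    refine (mul_le_mul_of_nonneg_left this hP.le).trans (le_of_eq ?_)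
    field_simp
  have h2 := div_le_div_of_nonneg_right
    (Finset.sum_le_sum fun h (_ : h ∈ Finset.univ) => h1 h) hc.le
  have h3 : (∑ h : BinVec u →ₗ[ZMod 2] BinVec N,
      2 ^ N * (Real.log (potential S θ h) - N * Real.log 2)) / C =
        2 ^ N * (meanLogPotential S θ N - N * Real.log 2) := by
    rw [← Finset.mul_sum, Finset.sum_sub_distrib, Finset.sum_const, Finset.card_univ,
      nsmul_eq_mul, meanLogPotential, ← hC]
    field_simp
  have h4 : (∑ h : BinVec u →ₗ[ZMod 2] BinVec N, (S.card * (θ - 1) +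
        S.card * θ ^ S.card *
          ∑ x ∈ Finset.univ.erase (0 : BinVec u), if h x = 0 then (1 : ℝ) else 0)) / C =
      S.card * (θ - 1) + S.card * θ ^ S.card * ((2 ^ u - 1) * (1 / 2 ^ N)) := by
    rw [Finset.sum_add_distrib, Finset.sum_const, ← Finset.mul_sum, Finset.sum_comm,
      Finset.card_univ, nsmul_eq_mul, add_div, ← hC, mul_div_cancel_left₀ _ hc.ne',
      mul_div_assoc, Finset.sum_div,
      Finset.sum_congr rfl (fun x hx => prob_apply_eq_zero (N := N) (Finset.ne_of_mem_erase hx)),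
      Finset.sum_const, Finset.card_erase_of_mem (Finset.mem_univ _), Finset.card_univ,
      nsmul_eq_mul, Nat.cast_sub Fintype.card_pos, card_binVec, Nat.cast_one]
  rw [h3, h4] at h2
  refine h2.trans ?_
  have h5 : 0 ≤ (S.card : ℝ) * θ ^ S.card * (1 / 2 ^ N) := by positivity
  rw [one_div_pow]
  linarith

/-- The mean log-potential is at most that of a fully independent hash function. -/
theorem meanLogPotential_le (hθ : 1 ≤ θ) (l : ℕ) :
    meanLogPotential S θ l ≤ l * Real.log 2 + avgLoad l S * (θ - 1) := by
  -- The scaled quantity at `l` is at most that at `l + k` for every `k`, so the collision term can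
  -- be sent to 0.
  have hlim : Filter.Tendsto (fun k : ℕ =>
      S.card * (θ - 1) + S.card * θ ^ S.card * 2 ^ u * (1 / 2 : ℝ) ^ (k + l))
      Filter.atTop (nhds (S.card * (θ - 1) + S.card * θ ^ S.card * 2 ^ u * 0)) :=
    (((Filter.tendsto_add_atTop_iff_nat l).2 (tendsto_pow_atTop_nhds_zero_of_lt_one
      (by norm_num) (by norm_num))).const_mul _).const_add _
  have h1 := ge_of_tendsto' hlim fun k => by
    rw [add_comm k l]
    exact (scaled_meanLogPotential_le S (zero_lt_one.trans_le hθ) l k).trans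
      (scaled_meanLogPotential_le_of_prob S hθ (l + k))
  rw [mul_zero, add_zero, mul_comm, ← le_div_iff₀ (by positivity)] at h1
  rw [avgLoad, div_mul_eq_mul_div]
  linarith

/-! ### From the potential to the maximum load -/

theorem maxLoad_mul_log_le {N : ℕ} (hθ : 1 ≤ θ) (h : BinVec u →ₗ[ZMod 2] BinVec N) :
    maxLoad S h * Real.log θ ≤ Real.log (potential S θ h) := by
  have hθ0 : 0 < θ := zero_lt_one.trans_le hθ
  obtain ⟨y, -, hy⟩ := Finset.exists_mem_eq_sup Finset.univ Finset.univ_nonempty (load S h)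
  rw [maxLoad, hy, ← Real.log_pow]
  exact Real.log_le_log (pow_pos hθ0 _)
    (Finset.single_le_sum (f := fun y => θ ^ load S h y)
      (fun _ _ => (pow_pos hθ0 _).le) (Finset.mem_univ y))

theorem expectedMaxLoad_mul_log_le (hθ : 1 ≤ θ) (l : ℕ) :
    expectedMaxLoad l S * Real.log θ ≤ l * Real.log 2 + avgLoad l S * (θ - 1) := by
  refine le_trans ?_ (meanLogPotential_le S hθ l)
  rw [expectedMaxLoad, meanLogPotential, div_mul_eq_mul_div, Finset.sum_mul]
  exact div_le_div_of_nonneg_right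
    (Finset.sum_le_sum fun h _ => maxLoad_mul_log_le S hθ h) (card_hash_pos u l).le

end Potential

/-- The expected maximum load is at most the load scale itself. -/
theorem expectedMaxLoad_le_loadScale {l u : ℕ} {S : Finset (BinVec u)} {t : ℝ}
    (hS : S.Nonempty) (ht : IsLoadScale (avgLoad l S) (2 ^ l) t) (h1 : 1 < t / avgLoad l S) :
    expectedMaxLoad l S ≤ t := by
  obtain ⟨ht0, ht⟩ := ht
  have hlam : 0 < avgLoad l S := by
    have : (0 : ℝ) < S.card := by exact_mod_cast hS.card_pos
    unfold avgLoad; positivity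
  -- Take θ = t/λ. The scale equation reads ln n = t ln(t/λ) − t, so the right side becomes t
  -- ln(t/λ) − λ.
  have hE := expectedMaxLoad_mul_log_le S h1.le l
  rw [mul_comm (Real.exp 1), ← div_div, Real.log_div (div_pos ht0 hlam).ne' (Real.exp_pos 1).ne',
    Real.log_exp, Real.log_pow] at ht
  rw [← ht, mul_sub, mul_sub, mul_div_cancel₀ _ hlam.ne'] at hE
  exact le_of_mul_le_mul_right (by linarith) (Real.log_pos h1)

end BinaryLinearHashing

/-- The `o(1)` is uniform: it is controlled by `t / λ` alone. -/
theorem corollaryC4 :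
    ∀ ε : ℝ, 0 < ε → ∃ K : ℝ, ∀ (l u : ℕ) (S : Finset (BinVec u)) (t : ℝ),
      S.Nonempty →
      BinaryLinearHashing.IsLoadScale (BinaryLinearHashing.avgLoad l S) ((2 : ℝ) ^ l) t →
      K ≤ t / BinaryLinearHashing.avgLoad l S →
      BinaryLinearHashing.expectedMaxLoad l S ≤ (1 + ε) * t := by
  -- Any constant above 1 would serve for `K`: the bound by `t` only needs `t / λ > 1`.
  refine fun ε hε => ⟨2, fun l u S t hS ht hK => ?_⟩
  have h := BinaryLinearHashing.expectedMaxLoad_le_loadScale hS ht (by linarith)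
  nlinarith [ht.1]
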